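/- Conventions. A graph $G$ is finite and consists of a vertex set $V_G$, a set $E^{\rm dir}_G$ of directed edges with head and tail maps $h_G,t_G\colon E^{\rm dir}_G\to V_G$, and an involution $\iota_G$ of $E^{\rm dir}_G$ with $t_G\iota_G=h_G$. Its edge set $E_G$ is the set of $\iota_G$-orbits; fixed points of $\iota_G$ are half-loops; its order is $\mathrm{ord}(G)=\#E_G-\#V_G$; it is $d$-regular if each vertex is the tail of exactly $d$ directed edges. The Hashimoto matrix of $G$ is indexed by $E^{\rm dir}_G$, with $(e,f)$ entry $1$ if $h_Ge=t_Gf$ and $\iota_Ge\ne f$, and $0$ otherwise; $\mu_1(G)$ is its Perron–Frobenius eigenvalue (its spectral radius). A strictly non-backtracking closed walk of length $k\ge1$ is a sequence $e_1,\dots,e_k$ of directed edges with $h_Ge_i=t_Ge_{i+1}$ and $\iota_Ge_i\ne e_{i+1}$ for all $i$, indices modulo $k$; the girth of $G$ is the least length of such a walk ($+\infty$ if there is none). A coordinatized cover of degree $n$ of a graph $B$ is a graph $G$ with $V_G=V_B\times[n]$, $E^{\rm dir}_G=E^{\rm dir}_B\times[n]$, $t_G(e,i)=(t_Be,i)$,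 $h_G(e,i)=(h_Be,\sigma(e)i)$, $\iota_G(e,i)=(\iota_Be,\sigma(e)i)$, for permutations $\sigma(e)$ of $[n]$ with $\sigma(\iota_Be)=\sigma(e)^{-1}$. A model over $B$ is a family $\{\mathcal C_n(B)\}_{n\in N}$, with $N$ an infinite set of positive integers, of finite probability spaces such that the atoms of $\mathcal C_n(B)$ (all of positive probability) are coordinatized covers of $B$ of degree $n$. A graph $S$ occurs in the model if there is a morphism $S\to B$ such that, for all sufficiently large $n\in N$, $S$ is isomorphic over $B$ to a subgraph of some atom of $\mathcal C_n(B)$. The tangle power $\tau_{\rm tang}$ of the model is the smallest order of a connected graph $S$ that occurs in it and satisfies $\mu_1(S)>\mu_1(B)^{1/2}$ ($+\infty$ if there is no such $S$). **Corollary.** Let $r,d\ge0$ be integers. 1. There is an integer $g$, depending only on $r$ and $d$, such that for every $d$-regular graph $B$ of girth greater than $g$ and every model over $B$, $\tau_{\rm tang}\ge r$. 2. Consequently $\tau_{\rm tang}$ can be arbitrarily large for $d$-regular base graphs: there is a (nonempty) connected $d$-regular graph $B$ such that every model over $B$ has $\tau_{\rm tang}\ge r$. -/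

import Mathlib

universe u

/-- A finite graph in the sense of a digraph with an edge-reversing involution: multiple edges,
whole-loops (`head e = tail e`, `inv e ≠ e`) and half-loops (`inv e = e`) are allowed.
`E` is the set of directed edges. -/
structure InvGraph : Type (u + 1) where
  V : Type u
  E : Type u
  [fintypeV : Fintype V]
  [fintypeE : Fintype E]
  head : E → V
  tail : E → V
  inv : E → E
  inv_inv : ∀ e, inv (inv e) = e
  tail_inv : ∀ e, tail (inv e) = head e

namespace InvGraph

attribute [instance] InvGraph.fintypeV InvGraph.fintypeE

/-- The set of undirected edges: the orbits of the involution. A half-loop gives a singleton. -/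
def edgeSet (G : InvGraph.{u}) : Set (Set G.E) :=
  Set.range fun e : G.E => ({e, G.inv e} : Set G.E)

/-- The order of a graph: number of (undirected) edges minus number of vertices. -/
noncomputable def order (G : InvGraph.{u}) : ℤ :=
  (G.edgeSet.ncard : ℤ) - (Fintype.card G.V : ℤ)

/-- Every vertex has degree `d`; whole-loops count twice, half-loops once. -/
def IsRegular (G : InvGraph.{u}) (d : ℕ) : Prop :=
  ∀ v : G.V, {e : G.E | G.tail e = v}.ncard = d

/-- Nonempty, and any two vertices are joined by a walk. -/
def IsConnected (G : InvGraph.{u}) : Prop :=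
  Nonempty G.V ∧
    ∀ v w : G.V, Relation.ReflTransGen (fun a b => ∃ e : G.E, G.tail e = a ∧ G.head e = b) v w

/-- `w 0, …, w (k-1)` are the directed edges of a strictly non-backtracking closed walk of
length `k`: cyclically consecutive edges are composable and never mutually inverse
(the last edge is followed by the first). -/
def IsSNBC (G : InvGraph.{u}) (k : ℕ) (w : Fin k → G.E) : Prop :=
  ∀ i j : Fin k, (j : ℕ) = ((i : ℕ) + 1) % k →
    G.head (w i) = G.tail (w j) ∧ G.inv (w i) ≠ w j

/-- The girth: the least positive length of a strictly non-backtracking closed walk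
(`⊤` if there is none). -/
noncomputable def girth (G : InvGraph.{u}) : ℕ∞ :=
  ⨅ k ∈ {k : ℕ | 0 < k ∧ ∃ w : Fin k → G.E, G.IsSNBC k w}, (k : ℕ∞)

open Classical in
/-- The Hashimoto (non-backtracking) matrix. -/
noncomputable def hashimoto (G : InvGraph.{u}) : Matrix G.E G.E ℂ :=
  Matrix.of fun e f => if G.head e = G.tail f ∧ G.inv e ≠ f then 1 else 0

open Classical in
/-- `μ₁(G)`, the Perron–Frobenius eigenvalue of the Hashimoto matrix. As that matrix is
nonnegative, this is its spectral radius (`0` if there are no edges). -/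
noncomputable def mu₁ (G : InvGraph.{u}) : ℝ :=
  (spectralRadius ℂ G.hashimoto).toReal

/-- A morphism of graphs. -/
structure Hom (G H : InvGraph.{u}) where
  onV : G.V → H.V
  onE : G.E → H.E
  head_comm : ∀ e, onV (G.head e) = H.head (onE e)
  tail_comm : ∀ e, onV (G.tail e) = H.tail (onE e)
  inv_comm : ∀ e, onE (G.inv e) = H.inv (onE e)

/-- The coordinatized covers of `B` of degree `n`, given by their permutation assignments. -/
structure Coord (B : InvGraph.{u}) (n : ℕ) where
  σ : B.E → Equiv.Perm (Fin n)
  σ_inv : ∀ e, σ (B.inv e) = (σ e)⁻¹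

namespace Coord

variable {B : InvGraph.{u}} {n : ℕ}

/-- The graph underlying a coordinatized cover. -/
def toGraph (c : Coord B n) : InvGraph.{u} where
  V := B.V × Fin n
  E := B.E × Fin n
  head p := (B.head p.1, c.σ p.1 p.2)
  tail p := (B.tail p.1, p.2)
  inv p := (B.inv p.1, c.σ p.1 p.2)
  inv_inv p := by simp [B.inv_inv, c.σ_inv]
  tail_inv p := by simp [B.tail_inv]

/-- The projection of a coordinatized cover to its base. -/
def proj (c : Coord B n) : Hom c.toGraph B where
  onV := Prod.fst
  onE := Prod.fst
  head_comm _ := rfl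
  tail_comm _ := rfl
  inv_comm _ := rfl

end Coord

/-- A model over `B`: an infinite set `N` of positive degrees and, for each `n ∈ N`, a probability
space whose atoms (the support of `prob n`) are coordinatized covers of `B` of degree `n`. -/
structure Model (B : InvGraph.{u}) where
  N : Set ℕ
  pos : ∀ n ∈ N, 0 < n
  infinite : N.Infinite
  prob : (n : N) → PMF (Coord B n)

namespace Model

variable {B : InvGraph.{u}}

/-- The `B`-graph `π : S → B` occurs in the model: for all sufficiently large `n ∈ N` it is
isomorphic to a `B`-subgraph of (i.e. maps injectively, over `B`, to) some atom. -/
def BGraphOccurs (C : Model B) (S : InvGraph.{u}) (π : Hom S B) : Prop :=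
  ∃ n₀ : ℕ, ∀ n : C.N, n₀ ≤ (n : ℕ) →
    ∃ c ∈ (C.prob n).support, ∃ f : Hom S c.toGraph,
      Function.Injective f.onV ∧ Function.Injective f.onE ∧
      (∀ v, c.proj.onV (f.onV v) = π.onV v) ∧ (∀ e, c.proj.onE (f.onE e) = π.onE e)

/-- The graph `S` occurs in the model if some `B`-graph structure on it does. -/
def Occurs (C : Model B) (S : InvGraph.{u}) : Prop :=
  ∃ π : Hom S B, C.BGraphOccurs S π

/-- The tangle power: the smallest order of a connected graph `S` occurring in the model with
`μ₁(S) > μ₁(B)^(1/2)`, and `+∞` if there is none. (Connected graphs have order at least `-1`, so the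
infimum of a nonempty set of such orders is attained.) -/
noncomputable def tanglePower (C : Model B) : EReal :=
  ⨅ S ∈ {S : InvGraph.{u} | C.Occurs S ∧ S.IsConnected ∧ Real.sqrt B.mu₁ < S.mu₁},
    ((S.order : ℝ) : EReal)

end Model

end InvGraph

/-! A subgraph of a cover of `B` immerses in `B`, so an occurring graph `S` has girth at least that
of `B` and degrees at most `d`. It remains to bound every nonzero eigenvalue `μ` of its Hashimoto
matrix.

An eigenvector for `μ ≠ 0` vanishes on edges that start no infinite non-backtracking walk, so at a
core edge the eigenvalue equation only sees core successors. Iterate it `m` times with `m` below the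
girth: the walks involved repeat no directed edge, so each passes every branch at most once, and
`‖μ‖ ^ m ≤ d ^ #branches` (`IsEigen.norm_pow_le`). A connected graph has at most `6 * order`
branches (`card_branches_le_order`). Hence order below `r` and `m` large in terms of `r` and `d`
force `‖μ‖ ≤ √(d - 1) ≤ √μ₁(B)` (`Hom.IsImmersion.mu₁_le_sqrt`).

For the second claim, let the involutive generators of a Cayley graph act on a ball of the
`d`-regular tree: a short reduced word moves the root, so it is not a relation
(`lt_girth_treeCayley`). -/

namespace InvGraph

open Finset

/-- `f` may follow `e` in a non-backtracking walk. -/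
def Step (G : InvGraph.{u}) (e f : G.E) : Prop :=
  G.head e = G.tail f ∧ G.inv e ≠ f

open Classical in
/-- The directed edges which may follow `e` in a non-backtracking walk. -/
noncomputable def nexts (G : InvGraph.{u}) (e : G.E) : Finset G.E :=
  univ.filter (G.Step e)

open Classical in
/-- The directed edges with tail `v`. -/
noncomputable def outs (G : InvGraph.{u}) (v : G.V) : Finset G.E :=
  univ.filter fun e => G.tail e = v

@[simp]
theorem mem_nexts {G : InvGraph.{u}} {e f : G.E} : f ∈ G.nexts e ↔ G.Step e f := by
  simp [nexts]

@[simp]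
theorem mem_outs {G : InvGraph.{u}} {v : G.V} {e : G.E} : e ∈ G.outs v ↔ G.tail e = v := by
  simp [outs]

theorem head_inv (G : InvGraph.{u}) (e : G.E) : G.head (G.inv e) = G.tail e := by
  rw [← G.tail_inv, G.inv_inv]

theorem inv_injective (G : InvGraph.{u}) : Function.Injective G.inv :=
  (show Function.Involutive G.inv from G.inv_inv).injective

theorem Step.inv {G : InvGraph.{u}} {e f : G.E} (h : G.Step e f) :
    G.Step (G.inv f) (G.inv e) := by
  refine ⟨by rw [head_inv, tail_inv, h.1], fun h' => h.2 ?_⟩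
  rw [← h', G.inv_inv]

/-! ### Eigenvalues of the Hashimoto matrix -/

/-- `x` is an eigenvector of the Hashimoto matrix for the eigenvalue `μ`. -/
def IsEigen (G : InvGraph.{u}) (μ : ℂ) (x : G.E → ℂ) : Prop :=
  x ≠ 0 ∧ ∀ e, ∑ f ∈ G.nexts e, x f = μ * x e

open Classical in
theorem mem_spectrum_hashimoto_iff (G : InvGraph.{u}) (μ : ℂ) :
    μ ∈ spectrum ℂ G.hashimoto ↔ ∃ x, G.IsEigen μ x := by
  have key : ∀ x : G.E → ℂ, (G.hashimoto.mulVec x = μ • x ↔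
      ∀ e, ∑ f ∈ G.nexts e, x f = μ * x e) := by
    intro x
    rw [funext_iff]
    refine forall_congr' fun e => ?_
    simp only [Matrix.mulVec, dotProduct, hashimoto, nexts, Step, Finset.sum_filter,
      Matrix.of_apply, ite_mul, one_mul, zero_mul, Pi.smul_apply, smul_eq_mul]
    refine Eq.congr_left (sum_congr rfl fun f _ => ?_)
    by_cases hf : G.head e = G.tail f ∧ G.inv e ≠ f <;> simp only [if_neg, hf, not_false_eq_true]
  rw [← Matrix.spectrum_toLin', ← Module.End.hasEigenvalue_iff_mem_spectrum]
  constructor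
  · intro h
    obtain ⟨x, hx⟩ := h.exists_hasEigenvector
    refine ⟨x, hx.2, (key x).1 ?_⟩
    simpa using hx.apply_eq_smul
  · rintro ⟨x, hx, h⟩
    refine Module.End.hasEigenvalue_of_hasEigenvector (x := x) ⟨?_, hx⟩
    rw [Module.End.mem_eigenspace_iff]
    simpa using (key x).2 h

theorem mu₁_le (G : InvGraph.{u}) {c : ℝ} (hc : 0 ≤ c)
    (h : ∀ μ x, G.IsEigen μ x → ‖μ‖ ≤ c) : G.mu₁ ≤ c := by
  classical
  refine ENNReal.toReal_le_of_le_ofReal hc (iSup₂_le fun μ hμ => ?_)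
  obtain ⟨x, hx⟩ := (mem_spectrum_hashimoto_iff G μ).1 hμ
  rw [← enorm_eq_nnnorm, ← ofReal_norm]
  exact ENNReal.ofReal_le_ofReal (h μ x hx)

theorem IsEigen.norm_le_mu₁ {G : InvGraph.{u}} {μ : ℂ} {x : G.E → ℂ} (hx : G.IsEigen μ x) :
    ‖μ‖ ≤ G.mu₁ := by
  classical
  have hμ : μ ∈ spectrum ℂ G.hashimoto := (mem_spectrum_hashimoto_iff G μ).2 ⟨x, hx⟩
  have hfin : (spectrum ℂ G.hashimoto).Finite := Matrix.finite_spectrum _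
  -- Finiteness matters because `toReal` sends `⊤` to `0`.
  have hne : spectralRadius ℂ G.hashimoto ≠ ⊤ := by
    obtain ⟨b, hb⟩ := (hfin.image (fun k : ℂ => ‖k‖₊)).bddAbove
    refine ne_top_of_le_ne_top (ENNReal.coe_ne_top (r := b)) (iSup₂_le fun k hk => ?_)
    exact_mod_cast hb ⟨k, hk, rfl⟩
  have h1 : (‖μ‖₊ : ENNReal) ≤ spectralRadius ℂ G.hashimoto :=
    le_iSup₂ (f := fun (k : ℂ) (_ : k ∈ spectrum ℂ G.hashimoto) => (‖k‖₊ : ENNReal)) μ hμ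
  exact (ENNReal.toReal_le_toReal ENNReal.coe_ne_top hne).2 h1

theorem IsEigen.norm_mul_norm_le {G : InvGraph.{u}} {μ : ℂ} {x : G.E → ℂ}
    (h : G.IsEigen μ x) (e : G.E) : ‖μ‖ * ‖x e‖ ≤ ∑ f ∈ G.nexts e, ‖x f‖ := by
  rw [← norm_mul, ← h.2]
  exact norm_sum_le _ _

/-! ### Regular graphs -/

theorem card_nexts_add_one (G : InvGraph.{u}) (e : G.E) :
    #(G.nexts e) + 1 = #(G.outs (G.head e)) := by
  classical
  have : G.outs (G.head e) = insert (G.inv e) (G.nexts e) := by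
    ext f
    rw [mem_insert, mem_outs, mem_nexts, Step]
    by_cases hf : f = G.inv e
    · simp [hf, G.tail_inv]
    · simp [hf, Ne.symm hf, eq_comm]
  rw [this, card_insert_of_notMem (by simp [Step])]

theorem IsRegular.card_outs {G : InvGraph.{u}} {d : ℕ} (h : G.IsRegular d) (v : G.V) :
    #(G.outs v) = d := by
  rw [← h v, ← Set.ncard_coe_finset]
  congr 1
  ext; simp

/-- The constant vector is an eigenvector. -/
theorem IsRegular.sub_one_le_mu₁ {G : InvGraph.{u}} {d : ℕ} (h : G.IsRegular d) (e₀ : G.E) :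
    (d : ℝ) - 1 ≤ G.mu₁ := by
  have h1 : G.IsEigen ((d : ℂ) - 1) (fun _ => 1) := by
    refine ⟨fun h0 => by simpa using congrFun h0 e₀, fun e => ?_⟩
    have h2 := G.card_nexts_add_one e
    rw [h.card_outs] at h2
    simp [← h2]
  refine le_trans ?_ h1.norm_le_mu₁
  have h3 : ((d : ℂ) - 1) = (((d : ℝ) - 1 : ℝ) : ℂ) := by push_cast; rfl
  rw [h3, Complex.norm_real]
  exact Real.le_norm_self _

/-- The row sum bound for the Perron–Frobenius eigenvalue. -/
theorem mu₁_le_of_card_outs_le {G : InvGraph.{u}} {d : ℕ} (hd : 1 ≤ d)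
    (h : ∀ v, #(G.outs v) ≤ d) : G.mu₁ ≤ (d : ℝ) - 1 := by
  have hd' : (1 : ℝ) ≤ d := by exact_mod_cast hd
  refine G.mu₁_le (by linarith) fun μ x hx => ?_
  obtain ⟨e₀, he₀⟩ := Function.ne_iff.1 hx.1
  obtain ⟨e, -, he⟩ := exists_max_image univ (fun e => ‖x e‖) ⟨e₀, mem_univ _⟩
  have hpos : 0 < ‖x e‖ := lt_of_lt_of_le (norm_pos_iff.2 he₀) (he e₀ (mem_univ _))
  have h3 : ((#(G.nexts e) : ℕ) : ℝ) ≤ d - 1 := by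
    have h6 : ((#(G.nexts e) + 1 : ℕ) : ℝ) ≤ d := by
      exact_mod_cast (G.card_nexts_add_one e).trans_le (h _)
    push_cast at h6
    linarith
  refine le_of_mul_le_mul_right ?_ hpos
  calc ‖μ‖ * ‖x e‖ ≤ ∑ f ∈ G.nexts e, ‖x f‖ := hx.norm_mul_norm_le e
    _ ≤ #(G.nexts e) • ‖x e‖ := sum_le_card_nsmul _ _ _ fun f _ => he f (mem_univ _)
    _ ≤ _ := by rw [nsmul_eq_mul]; gcongr

/-! ### The core -/

/-- `e` starts an infinite non-backtracking walk. -/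
def IsLive (G : InvGraph.{u}) (e : G.E) : Prop :=
  ∃ w : ℕ → G.E, w 0 = e ∧ ∀ n, G.Step (w n) (w (n + 1))

theorem IsLive.exists_step {G : InvGraph.{u}} {e : G.E} (h : G.IsLive e) :
    ∃ f, G.Step e f ∧ G.IsLive f := by
  obtain ⟨w, rfl, hw⟩ := h
  exact ⟨w 1, hw 0, fun n => w (n + 1), rfl, fun n => hw (n + 1)⟩

theorem exists_walk_of_forall_exists_step {G : InvGraph.{u}} {P : G.E → Prop}
    (h : ∀ e, P e → ∃ f, G.Step e f ∧ P f) {e : G.E} (he : P e) :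
    ∃ w : ℕ → G.E, w 0 = e ∧ (∀ n, G.Step (w n) (w (n + 1))) ∧ ∀ n, P (w n) := by
  choose! s hs hP using h
  have hw : ∀ n, P (s^[n] e) := by
    intro n
    induction n with
    | zero => exact he
    | succ n ih => rw [Function.iterate_succ_apply']; exact hP _ ih
  exact ⟨fun n => s^[n] e, rfl,
    fun n => by simpa only [Function.iterate_succ_apply'] using hs _ (hw n), hw⟩

theorem Step.isLive {G : InvGraph.{u}} {e f : G.E} (h : G.Step e f) (hf : G.IsLive f) :
    G.IsLive e := by
  obtain ⟨w, hw, hs, -⟩ := exists_walk_of_forall_exists_step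
    (P := fun e => ∃ f, G.Step e f ∧ G.IsLive f)
    (fun e ⟨f, hef, hf⟩ => ⟨f, hef, hf.exists_step⟩) ⟨f, h, hf⟩
  exact ⟨w, hw, hs⟩

open Classical in
/-- The directed edges `e` such that infinite non-backtracking walks start at both `e` and its
inverse. -/
noncomputable def core (G : InvGraph.{u}) : Finset G.E :=
  univ.filter fun e => G.IsLive e ∧ G.IsLive (G.inv e)

theorem mem_core {G : InvGraph.{u}} {e : G.E} :
    e ∈ G.core ↔ G.IsLive e ∧ G.IsLive (G.inv e) := by
  simp [core]

theorem inv_mem_core {G : InvGraph.{u}} {e : G.E} (h : e ∈ G.core) : G.inv e ∈ G.core := by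
  rw [mem_core] at *
  rw [G.inv_inv]
  exact h.symm

theorem Step.mem_core {G : InvGraph.{u}} {e f : G.E} (h : G.Step e f) (he : e ∈ G.core)
    (hf : G.IsLive f) : f ∈ G.core := by
  rw [InvGraph.mem_core] at *
  exact ⟨hf, h.inv.isLive he.2⟩

theorem exists_step_mem_core {G : InvGraph.{u}} {e : G.E} (he : e ∈ G.core) :
    ∃ f ∈ G.core, G.Step e f := by
  obtain ⟨f, hef, hf⟩ := (mem_core.1 he).1.exists_step
  exact ⟨f, hef.mem_core he hf, hef⟩

/-- An edge to which a non-backtracking walk returns is in the core. -/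
theorem mem_core_of_eq {G : InvGraph.{u}} {w : ℕ → G.E} (hw : ∀ n, G.Step (w n) (w (n + 1)))
    {i j : ℕ} (hij : i < j) (h : w i = w j) : w j ∈ G.core := by
  refine mem_core.2 ⟨⟨fun n => w (j + n), rfl, fun n => hw _⟩, ?_⟩
  obtain ⟨v, hv, hs, -⟩ := exists_walk_of_forall_exists_step (G := G)
    -- Run around the loop backwards through inverses; on reaching index `i`, jump to `j`, which
    -- carries the same edge.
    (P := fun e => ∃ k, i < k ∧ k ≤ j ∧ e = G.inv (w k)) (by
      rintro _ ⟨k, hik, hkj, rfl⟩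
      obtain ⟨k, rfl⟩ : ∃ l, k = l + 1 := ⟨k - 1, by omega⟩
      refine ⟨G.inv (w k), (hw k).inv, ?_⟩
      rcases (Nat.lt_succ_iff.1 hik).eq_or_lt with rfl | hlt
      · exact ⟨j, hij, le_rfl, by rw [h]⟩
      · exact ⟨k, hlt, by omega, rfl⟩) (e := G.inv (w j)) ⟨j, hij, le_rfl, rfl⟩
  exact ⟨v, hv, hs⟩

theorem IsEigen.exists_step {G : InvGraph.{u}} {μ : ℂ} {x : G.E → ℂ} (h : G.IsEigen μ x)
    (hμ : μ ≠ 0) (e : G.E) (he : x e ≠ 0) : ∃ f, G.Step e f ∧ x f ≠ 0 := by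
  by_contra! hc
  have h1 := h.2 e
  rw [sum_eq_zero fun f hf => hc f (mem_nexts.1 hf)] at h1
  exact mul_ne_zero hμ he h1.symm

theorem IsEigen.isLive {G : InvGraph.{u}} {μ : ℂ} {x : G.E → ℂ} (h : G.IsEigen μ x)
    (hμ : μ ≠ 0) {e : G.E} (he : x e ≠ 0) : G.IsLive e := by
  obtain ⟨w, hw, hs, -⟩ := exists_walk_of_forall_exists_step (h.exists_step hμ) he
  exact ⟨w, hw, hs⟩

/-- Following nonzero entries gives an infinite walk; it must revisit an edge, since there are
finitely many. -/
theorem IsEigen.exists_mem_core {G : InvGraph.{u}} {μ : ℂ} {x : G.E → ℂ} (h : G.IsEigen μ x)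
    (hμ : μ ≠ 0) : ∃ e ∈ G.core, x e ≠ 0 := by
  obtain ⟨e₀, he₀⟩ := Function.ne_iff.1 h.1
  obtain ⟨w, -, hs, hx⟩ := exists_walk_of_forall_exists_step (h.exists_step hμ) he₀
  obtain ⟨i, j, hij, hw⟩ := Finite.exists_ne_map_eq_of_infinite w
  rcases lt_or_gt_of_ne hij with hlt | hlt
  · exact ⟨w j, mem_core_of_eq hs hlt hw, hx j⟩
  · exact ⟨w i, mem_core_of_eq hs hlt hw.symm, hx i⟩

/-- The directed edges of the core which may follow `e` in a non-backtracking walk. -/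
noncomputable def coreNexts (G : InvGraph.{u}) (e : G.E) : Finset G.E :=
  open Classical in G.nexts e ∩ G.core

/-- A successor of a core edge that lies outside the core is not live, so the eigenvector vanishes
there. -/
theorem IsEigen.norm_mul_norm_le_core {G : InvGraph.{u}} {μ : ℂ} {x : G.E → ℂ}
    (h : G.IsEigen μ x) (hμ : μ ≠ 0) {e : G.E} (he : e ∈ G.core) :
    ‖μ‖ * ‖x e‖ ≤ ∑ f ∈ G.coreNexts e, ‖x f‖ := by
  classical
  refine (h.norm_mul_norm_le e).trans_eq (sum_subset inter_subset_left fun f hf hfc => ?_).symm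
  by_contra hx
  refine hfc (mem_inter.2 ⟨hf, (mem_nexts.1 hf).mem_core he (h.isLive hμ ?_)⟩)
  simpa using hx

/-! ### Walks shorter than the girth -/

/-- A repetition would close up to a strictly non-backtracking walk of length `j - i ≤ m`. -/
theorem ne_of_lt_girth {G : InvGraph.{u}} {m : ℕ} (hg : (m : ℕ∞) < G.girth) {w : ℕ → G.E} {n : ℕ}
    (hw : ∀ j < n, G.Step (w j) (w (j + 1))) (hn : n ≤ m) {i j : ℕ} (hij : i < j) (hj : j ≤ n) :
    w i ≠ w j := by
  intro h
  have hlt : 0 < j - i := by omega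
  have : G.girth ≤ ((j - i : ℕ) : ℕ∞) := by
    refine iInf₂_le (j - i) ⟨hlt, fun k => w (i + k), ?_⟩
    intro a b hab
    have ha := a.2
    have hs := hw (i + a) (by omega)
    rcases (show (a : ℕ) + 1 ≤ j - i by omega).eq_or_lt with h1 | h1
    · rw [h1, Nat.mod_self] at hab
      have : i + (a : ℕ) + 1 = j := by omega
      rw [this, ← h] at hs
      have hb : w (i + (b : ℕ)) = w i := by rw [hab, Nat.add_zero]
      rw [← hb] at hs
      exact hs
    · rw [Nat.mod_eq_of_lt h1] at hab
      have hb : i + (b : ℕ) = i + a + 1 := by omega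
      rw [← hb] at hs
      exact hs
  have h2 := hg.trans_le this
  have : m < j - i := by exact_mod_cast h2
  omega

open Classical in
/-- The directed edges of the core after which a walk in the core has a choice. -/
noncomputable def branches (G : InvGraph.{u}) : Finset G.E :=
  G.core.filter fun e => 1 < #(G.coreNexts e)

-- Induction on the number `k` of steps left. The exponent counts the branches not yet used by the
-- walk `w 0, …, w (i-1)`: leaving a branch costs a factor `D` and uses it up, any other step is
-- free.
open Classical in
theorem IsEigen.pow_mul_norm_le {G : InvGraph.{u}} {μ : ℂ} {x : G.E → ℂ}
    (h : G.IsEigen μ x) (hμ : μ ≠ 0) {m D : ℕ} (hg : (m : ℕ∞) < G.girth) (hD : 1 ≤ D)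
    (hdeg : ∀ e, #(G.coreNexts e) ≤ D) {M : ℝ} (hM : ∀ e ∈ G.core, ‖x e‖ ≤ M) (k : ℕ) :
    ∀ i, i + k = m → ∀ w : ℕ → G.E, (∀ j < i, G.Step (w j) (w (j + 1))) → w i ∈ G.core →
      ‖μ‖ ^ k * ‖x (w i)‖ ≤ M * (D : ℝ) ^ #(G.branches \ (range i).image w) := by
  have hD' : (1 : ℝ) ≤ D := by exact_mod_cast hD
  induction k with
  | zero =>
    intro i _ w _ hwi
    have hM0 : 0 ≤ M := (norm_nonneg _).trans (hM _ hwi)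
    rw [pow_zero, one_mul]
    exact (hM _ hwi).trans (le_mul_of_one_le_right hM0 (one_le_pow₀ hD'))
  | succ k ih =>
    intro i hik w hw hwi
    have hM0 : 0 ≤ M := (norm_nonneg _).trans (hM _ hwi)
    set Z := (range i).image w with hZ
    have hnot : w i ∉ Z := by
      intro hmem
      obtain ⟨j, hj, hjw⟩ := mem_image.1 hmem
      exact ne_of_lt_girth hg hw (by omega) (mem_range.1 hj) le_rfl hjw
    have hstep : ∀ f ∈ G.coreNexts (w i),
        ‖μ‖ ^ k * ‖x f‖ ≤ M * (D : ℝ) ^ #(G.branches \ insert (w i) Z) := by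
      intro f hf
      obtain ⟨hf1, hf2⟩ := mem_inter.1 hf
      have h1 := ih (i + 1) (by omega) (fun j => if j ≤ i then w j else f) (by
        intro j hj
        rcases (Nat.lt_succ_iff.1 hj).eq_or_lt with rfl | hlt
        · simpa using mem_nexts.1 hf1
        · simpa [hlt.le, Nat.succ_le_of_lt hlt] using hw j hlt) (by simpa using hf2)
      have h2 : (range (i + 1)).image (fun j => if j ≤ i then w j else f) = insert (w i) Z := by
        rw [range_add_one, image_insert, if_pos le_rfl, hZ]
        congr 1
        exact image_congr fun j hj => if_pos (mem_range.1 (mem_coe.1 hj)).le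
      rw [h2] at h1
      simpa using h1
    have hsum : ‖μ‖ ^ (k + 1) * ‖x (w i)‖ ≤
        #(G.coreNexts (w i)) * (M * (D : ℝ) ^ #(G.branches \ insert (w i) Z)) := by
      calc ‖μ‖ ^ (k + 1) * ‖x (w i)‖ = ‖μ‖ ^ k * (‖μ‖ * ‖x (w i)‖) := by ring
        _ ≤ ‖μ‖ ^ k * ∑ f ∈ G.coreNexts (w i), ‖x f‖ := by
          gcongr; exact h.norm_mul_norm_le_core hμ hwi
        _ = ∑ f ∈ G.coreNexts (w i), ‖μ‖ ^ k * ‖x f‖ := mul_sum _ _ _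
        _ ≤ _ := by simpa using sum_le_card_nsmul _ _ _ hstep
    refine hsum.trans ?_
    by_cases hb : w i ∈ G.branches
    · have hcard : #(G.branches \ insert (w i) Z) + 1 = #(G.branches \ Z) := by
        rw [sdiff_insert, card_erase_add_one (mem_sdiff.2 ⟨hb, hnot⟩)]
      rw [← hcard, pow_succ]
      have h1 : ((#(G.coreNexts (w i)) : ℕ) : ℝ) ≤ D := by exact_mod_cast hdeg _
      calc _ ≤ (D : ℝ) * (M * (D : ℝ) ^ #(G.branches \ insert (w i) Z)) := by gcongr
        _ = _ := by ring
    · have h1 : ((#(G.coreNexts (w i)) : ℕ) : ℝ) ≤ 1 := by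
        have : ¬ 1 < #(G.coreNexts (w i)) := fun h1 => hb (mem_filter.2 ⟨hwi, h1⟩)
        exact_mod_cast not_lt.1 this
      calc _ ≤ 1 * (M * (D : ℝ) ^ #(G.branches \ insert (w i) Z)) := by gcongr
        _ ≤ _ := by
          rw [one_mul]
          gcongr M * ?_
          exact pow_le_pow_right₀ hD' (card_le_card (sdiff_subset_sdiff subset_rfl
            (subset_insert _ _)))

/-- An eigenvalue of the Hashimoto matrix is small if the graph has large girth and few branches. -/
theorem IsEigen.norm_pow_le {G : InvGraph.{u}} {μ : ℂ} {x : G.E → ℂ}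
    (h : G.IsEigen μ x) (hμ : μ ≠ 0) {m D : ℕ} (hg : (m : ℕ∞) < G.girth) (hD : 1 ≤ D)
    (hdeg : ∀ v, #(G.outs v) ≤ D) : ‖μ‖ ^ m ≤ (D : ℝ) ^ #G.branches := by
  classical
  obtain ⟨e₀, he₀, hx₀⟩ := h.exists_mem_core hμ
  obtain ⟨e, hec, he⟩ := exists_max_image G.core (fun e => ‖x e‖) ⟨e₀, he₀⟩
  have hpos : 0 < ‖x e‖ := lt_of_lt_of_le (norm_pos_iff.2 hx₀) (he e₀ he₀)
  have hdeg' : ∀ e, #(G.coreNexts e) ≤ D := fun e => by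
    have h1 := G.card_nexts_add_one e
    have h2 := hdeg (G.head e)
    have h3 : #(G.coreNexts e) ≤ #(G.nexts e) := card_le_card inter_subset_left
    omega
  have h1 := h.pow_mul_norm_le hμ hg hD hdeg' he m 0 (by simp) (fun _ => e) (by simp) hec
  refine le_of_mul_le_mul_right ?_ hpos
  simpa [mul_comm] using h1

end InvGraph

namespace InvGraph

open Finset

/-! ### The order of a graph with few branches -/

open Classical in
/-- The vertices of the core. -/
noncomputable def coreVerts (G : InvGraph.{u}) : Finset G.V :=
  G.core.image G.tail

theorem tail_mem_coreVerts {G : InvGraph.{u}} {e : G.E} (he : e ∈ G.core) :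
    G.tail e ∈ G.coreVerts := by
  classical exact mem_image_of_mem _ he

open Classical in
theorem card_coreNexts_add_one {G : InvGraph.{u}} {e : G.E} (he : e ∈ G.core) :
    #(G.coreNexts e) + 1 = #{f ∈ G.core | G.tail f = G.head e} := by
  have : {f ∈ G.core | G.tail f = G.head e} = insert (G.inv e) (G.coreNexts e) := by
    ext f
    rw [mem_filter, mem_insert, coreNexts, mem_inter, mem_nexts, Step]
    by_cases hf : f = G.inv e
    · simp [hf, G.tail_inv, inv_mem_core he]
    · simp [hf, Ne.symm hf, eq_comm, and_comm]
  rw [this, card_insert_of_notMem (by simp [coreNexts, Step])]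

theorem card_coreNexts_pos {G : InvGraph.{u}} {e : G.E} (he : e ∈ G.core) :
    0 < #(G.coreNexts e) := by
  classical
  obtain ⟨f, hf, hef⟩ := exists_step_mem_core he
  exact card_pos.2 ⟨f, mem_inter.2 ⟨mem_nexts.2 hef, hf⟩⟩

/-- Compare at each core vertex, of core degree `c ≥ 2`. If `c = 2`, no branch ends there and `0 + 6
≤ 3 * c`; if `c ≥ 3`, at most `c` do and `c + 6 ≤ 3 * c`. -/
theorem card_branches_add_le (G : InvGraph.{u}) :
    #G.branches + 6 * #G.coreVerts ≤ 3 * #G.core := by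
  classical
  have hmaps : ∀ e ∈ G.branches, G.head e ∈ G.coreVerts := fun e he => by
    rw [← G.tail_inv]
    exact tail_mem_coreVerts (inv_mem_core (mem_filter.1 he).1)
  rw [card_eq_sum_card_fiberwise hmaps,
    card_eq_sum_card_fiberwise (f := G.tail) (t := G.coreVerts) fun e he => tail_mem_coreVerts he,
    mul_sum, mul_comm, ← smul_eq_mul, ← sum_const, ← sum_add_distrib]
  refine sum_le_sum fun v hv => ?_
  have hinv : #{e ∈ G.branches | G.head e = v} ≤ #{e ∈ G.core | G.tail e = v} := by
    refine card_le_card_of_injOn G.inv (fun e he => ?_) G.inv_injective.injOn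
    obtain ⟨h1, h2⟩ := mem_filter.1 (mem_coe.1 he)
    exact mem_coe.2 (mem_filter.2 ⟨inv_mem_core (mem_filter.1 h1).1, by rw [G.tail_inv, h2]⟩)
  rcases eq_empty_or_nonempty {e ∈ G.branches | G.head e = v} with h0 | ⟨e, he⟩
  · obtain ⟨e, he, rfl⟩ := mem_image.1 hv
    have h1 := card_coreNexts_pos (inv_mem_core he)
    have h2 := card_coreNexts_add_one (inv_mem_core he)
    rw [head_inv] at h2
    rw [h0, card_empty]
    omega
  · obtain ⟨h1, rfl⟩ := mem_filter.1 he
    obtain ⟨h2, h3⟩ := mem_filter.1 h1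
    have h4 := card_coreNexts_add_one h2
    omega

/-- Take `f` to be the distance to `A`; `R n v` says that `A` can be reached from `v` in `n` steps.
-/
theorem IsConnected.exists_descent {G : InvGraph.{u}} (hG : G.IsConnected) {A : Finset G.V}
    (hA : A.Nonempty) :
    ∃ f : G.V → ℕ, ∀ v ∉ A, ∃ e, G.tail e = v ∧ f (G.head e) < f v := by
  classical
  obtain ⟨a, ha⟩ := hA
  let R : ℕ → G.V → Prop :=
    fun n => Nat.rec (fun v => v ∈ A) (fun _ P v => ∃ e, G.tail e = v ∧ P (G.head e)) n
  have hR : ∀ v, ∃ n, R n v := by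
    intro v
    induction hG.2 v a using Relation.ReflTransGen.head_induction_on with
    | refl => exact ⟨0, ha⟩
    | head h _ ih =>
      obtain ⟨e, rfl, rfl⟩ := h
      obtain ⟨n, hn⟩ := ih
      exact ⟨n + 1, e, rfl, hn⟩
  refine ⟨fun v => sInf {n | R n v}, fun v hv => ?_⟩
  have hs : R (sInf {n | R n v}) v := Nat.sInf_mem (hR v)
  obtain ⟨k, hk⟩ : ∃ k, sInf {n | R n v} = k + 1 := by
    refine Nat.exists_eq_succ_of_ne_zero fun h0 => ?_
    rw [h0] at hs
    exact hv hs
  rw [hk] at hs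
  obtain ⟨e, he, hRe⟩ := hs
  refine ⟨e, he, ?_⟩
  have : sInf {n | R n (G.head e)} ≤ k := Nat.sInf_le hRe
  exact (Nat.lt_succ_of_le this).trans_eq hk.symm

/-- The undirected edge underlying `e`. -/
def orbit (G : InvGraph.{u}) (e : G.E) : Set G.E :=
  {e, G.inv e}

theorem orbit_eq_iff {G : InvGraph.{u}} {e f : G.E} :
    G.orbit e = G.orbit f ↔ e = f ∨ e = G.inv f := by
  constructor
  · intro h
    have : e ∈ G.orbit f := h ▸ Set.mem_insert _ _
    simpa [orbit] using this
  · rintro (rfl | rfl)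
    · rfl
    · rw [orbit, G.inv_inv, Set.pair_comm, orbit]

/-- Each vertex outside the core owns the first edge of a shortest path to it. These edges are
distinct and outside the core, so deleting them with their vertices leaves the order unchanged and
keeps all core edges. -/
theorem card_core_le_order {G : InvGraph.{u}} (hG : G.IsConnected) (hc : G.core.Nonempty) :
    (#G.core : ℤ) ≤ 2 * G.order + 2 * #G.coreVerts := by
  classical
  have hcv : G.coreVerts.Nonempty := hc.image _
  obtain ⟨f, hf⟩ := hG.exists_descent hcv
  have : Nonempty G.E := ⟨hc.choose⟩
  choose! s hs hlt using hf
  set O := G.core.image G.orbit with hO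
  set T := (univ \ G.coreVerts).image fun v => G.orbit (s v) with hT
  have hcore : #G.core ≤ 2 * #O := by
    refine card_le_mul_card_image _ 2 fun o ho => ?_
    obtain ⟨e, -, rfl⟩ := mem_image.1 ho
    refine (card_le_card (t := {e, G.inv e}) fun f hf => ?_).trans card_le_two
    simpa using orbit_eq_iff.1 (mem_filter.1 hf).2
  have hTcard : #T + #G.coreVerts = Fintype.card G.V := by
    rw [hT, card_image_of_injOn, card_sdiff_add_card_eq_card (subset_univ _), card_univ]
    intro v hv w hw hvw
    have hv' : v ∉ G.coreVerts := by simpa using hv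
    have hw' : w ∉ G.coreVerts := by simpa using hw
    rcases orbit_eq_iff.1 hvw with h | h
    · rw [← hs v hv', ← hs w hw', h]
    · have h1 : G.head (s w) = v := by rw [← G.tail_inv, ← h, hs v hv']
      have h2 : G.head (s v) = w := by rw [h, head_inv, hs w hw']
      have h3 := hlt v hv'
      have h4 := hlt w hw'
      rw [h2] at h3
      rw [h1] at h4
      omega
  have hdisj : Disjoint O T := by
    rw [Finset.disjoint_left]
    intro o ho ht
    obtain ⟨e, he, rfl⟩ := mem_image.1 ho
    obtain ⟨v, hv, hve⟩ := mem_image.1 ht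
    have hv' : v ∉ G.coreVerts := by simpa using hv
    have : s v ∈ G.core := by
      rcases orbit_eq_iff.1 hve with h | h
      · rwa [h]
      · rw [h]; exact inv_mem_core he
    exact hv' (hs v hv' ▸ tail_mem_coreVerts this)
  have hedge : #O + #T ≤ G.edgeSet.ncard := by
    rw [← card_union_of_disjoint hdisj, ← Set.ncard_coe_finset]
    refine Set.ncard_le_ncard ?_ (Set.finite_range _)
    intro o ho
    rcases mem_union.1 (mem_coe.1 ho) with h | h
    · obtain ⟨e, -, rfl⟩ := mem_image.1 h
      exact ⟨e, rfl⟩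
    · obtain ⟨v, -, rfl⟩ := mem_image.1 h
      exact ⟨s v, rfl⟩
  rw [order]
  omega

theorem card_branches_le_order {G : InvGraph.{u}} (hG : G.IsConnected) (hc : G.core.Nonempty) :
    (#G.branches : ℤ) ≤ 6 * G.order := by
  have h1 := card_core_le_order hG hc
  have h2 := G.card_branches_add_le
  omega

/-! ### Immersions -/

/-- A morphism which is injective on the directed edges with a given tail. -/
def Hom.IsImmersion {S B : InvGraph.{u}} (π : Hom S B) : Prop :=
  ∀ e f, S.tail e = S.tail f → π.onE e = π.onE f → e = f

theorem Hom.IsImmersion.step {S B : InvGraph.{u}} {π : Hom S B} (h : π.IsImmersion) {e f : S.E}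
    (hs : S.Step e f) : B.Step (π.onE e) (π.onE f) := by
  refine ⟨by rw [← π.head_comm, ← π.tail_comm, hs.1], fun h' => hs.2 ?_⟩
  exact h _ _ (by rw [S.tail_inv, hs.1]) (by rw [π.inv_comm, h'])

theorem Hom.IsImmersion.girth_le {S B : InvGraph.{u}} {π : Hom S B} (h : π.IsImmersion) :
    B.girth ≤ S.girth := by
  refine le_iInf₂ fun k ⟨hk, w, hw⟩ => iInf₂_le k ⟨hk, fun i => π.onE (w i), ?_⟩
  exact fun i j hij => h.step (hw i j hij)

theorem Hom.IsImmersion.card_outs_le {S B : InvGraph.{u}} {π : Hom S B} (h : π.IsImmersion)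
    (v : S.V) : #(S.outs v) ≤ #(B.outs (π.onV v)) := by
  refine card_le_card_of_injOn π.onE (fun e he => ?_) fun e he f hf => h e f ?_
  · rw [mem_coe, mem_outs] at *
    rw [← π.tail_comm, he]
  · rw [mem_coe, mem_outs] at *
    rw [he, hf]

/-- An edge of a cover is determined by its projection and the sheet of its tail. -/
theorem Model.BGraphOccurs.isImmersion {B S : InvGraph.{u}} {C : Model B} {π : Hom S B}
    (h : C.BGraphOccurs S π) : π.IsImmersion := by
  obtain ⟨n₀, h⟩ := h
  obtain ⟨n, hn, hn₀⟩ := C.infinite.exists_gt n₀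
  obtain ⟨c, -, f, -, hfE, -, hπ⟩ := h ⟨n, hn⟩ hn₀.le
  intro e e' htail he
  rw [← hπ, ← hπ] at he
  have h1 := f.tail_comm e
  rw [htail, f.tail_comm e'] at h1
  exact hfE (Prod.ext he (congrArg Prod.snd h1).symm)

/-- Connected graphs of small order which immerse into a regular graph of large girth have
small Perron–Frobenius eigenvalue. -/
theorem Hom.IsImmersion.mu₁_le_sqrt {S B : InvGraph.{u}} {π : Hom S B} (h : π.IsImmersion)
    {r d : ℕ} (hB : B.IsRegular d) (hg : ((2 * d ^ (6 * r) + 1 : ℕ) : ℕ∞) < B.girth)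
    (hS : S.IsConnected) (hr : S.order < r) : S.mu₁ ≤ √B.mu₁ := by
  refine S.mu₁_le (Real.sqrt_nonneg _) fun μ x hx => ?_
  obtain ⟨e₀, -⟩ := Function.ne_iff.1 hx.1
  refine le_trans ?_ (Real.sqrt_le_sqrt (hB.sub_one_le_mu₁ (π.onE e₀)))
  have hdeg : ∀ v, #(S.outs v) ≤ d := fun v => hB.card_outs (π.onV v) ▸ h.card_outs_le v
  have hd : 1 ≤ d := (card_pos.2 ⟨e₀, mem_outs.2 rfl⟩).trans_le (hdeg (S.tail e₀))
  have hd' : (1 : ℝ) ≤ d := by exact_mod_cast hd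
  -- For `d ≤ 2` the row sum bound suffices, as `(d - 1)² ≤ d - 1`; otherwise `d - 1 ≥ 2`.
  rcases le_or_gt d 2 with hd2 | hd3
  · refine hx.norm_le_mu₁.trans ((mu₁_le_of_card_outs_le hd hdeg).trans (Real.le_sqrt_of_sq_le ?_))
    have : (d : ℝ) ≤ 2 := by exact_mod_cast hd2
    nlinarith
  · refine Real.le_sqrt_of_sq_le ?_
    by_contra! hlt
    have hd3' : (3 : ℝ) ≤ d := by exact_mod_cast hd3
    have hsq : (2 : ℝ) < ‖μ‖ ^ 2 := by linarith
    have hμ : μ ≠ 0 := by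
      rintro rfl
      norm_num at hsq
    set K := d ^ (6 * r) with hK
    obtain ⟨e, he, -⟩ := hx.exists_mem_core hμ
    have hbr : #S.branches ≤ 6 * r := by
      have := card_branches_le_order hS ⟨e, he⟩
      omega
    have h1 : ‖μ‖ ^ (2 * K + 1) ≤ K := by
      refine (hx.norm_pow_le hμ (hg.trans_le h.girth_le) hd hdeg).trans ?_
      rw [hK, Nat.cast_pow]
      exact pow_le_pow_right₀ hd' hbr
    have h2 : (2 : ℝ) ^ (2 * K + 1) ≤ (K : ℝ) ^ 2 := by
      calc (2 : ℝ) ^ (2 * K + 1) ≤ (‖μ‖ ^ 2) ^ (2 * K + 1) := by gcongr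
        _ = (‖μ‖ ^ (2 * K + 1)) ^ 2 := by rw [← pow_mul, ← pow_mul, mul_comm]
        _ ≤ _ := by gcongr
    -- The girth bound `2 * K + 1` is chosen to contradict `K ^ 2 ≤ 2 ^ (2 * K)`.
    have h3 : 2 ^ (2 * K + 1) ≤ K ^ 2 := by exact_mod_cast h2
    have h4 : K ^ 2 ≤ (2 ^ K) ^ 2 := Nat.pow_le_pow_left Nat.lt_two_pow_self.le 2
    rw [← pow_mul 2, mul_comm K 2] at h4
    exact absurd (h3.trans h4) (not_le.2 (Nat.pow_lt_pow_right one_lt_two (Nat.lt_succ_self _)))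

theorem le_tanglePower {B : InvGraph.{u}} {r d : ℕ} (hB : B.IsRegular d)
    (hg : ((2 * d ^ (6 * r) + 1 : ℕ) : ℕ∞) < B.girth) (C : B.Model) :
    (r : EReal) ≤ C.tanglePower := by
  refine le_iInf₂ fun S ⟨⟨π, hπ⟩, hS, hlt⟩ => ?_
  have h1 : (r : ℤ) ≤ S.order := by
    by_contra! hr
    exact hlt.not_ge (hπ.isImmersion.mu₁_le_sqrt hB hg hS hr)
  have h2 : (r : ℝ) ≤ S.order := by exact_mod_cast h1
  exact_mod_cast h2

end InvGraph

/-! ### Regular graphs of large girth -/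

/-- The reduced words of length at most `R` in `d` letters: the ball of radius `R` in the
`d`-regular tree. -/
abbrev ReducedWord (d R : ℕ) : Type :=
  {l : List (Fin d) // l.IsChain (· ≠ ·) ∧ l.length ≤ R}

namespace ReducedWord

variable {d R : ℕ}

instance : Finite (ReducedWord d R) :=
  ((List.finite_length_le (Fin d) R).subset fun _ hl => hl.2).to_subtype

/-- Multiplication by the involution `i` in the ball, where it stays in the ball. -/
def swap (i : Fin d) (l : ReducedWord d R) : ReducedWord d R :=
  if h : l.1.head? = some i then ⟨l.1.tail, l.2.1.tail, by
    rw [List.length_tail]; exact (Nat.sub_le _ _).trans l.2.2⟩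
  else if hR : l.1.length < R then ⟨i :: l.1, List.isChain_cons.2 ⟨by
    rintro y hy rfl
    exact h hy, l.2.1⟩, hR⟩
  else l

theorem swap_of_head? {i : Fin d} {l : ReducedWord d R} (h : l.1.head? = some i) :
    (swap i l).1 = l.1.tail := by
  rw [swap, dif_pos h]

theorem swap_of_head?_ne {i : Fin d} {l : ReducedWord d R} (h : l.1.head? ≠ some i)
    (hR : l.1.length < R) : (swap i l).1 = i :: l.1 := by
  rw [swap, dif_neg h, dif_pos hR]

theorem swap_swap (i : Fin d) (l : ReducedWord d R) : swap i (swap i l) = l := by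
  by_cases h : l.1.head? = some i
  · obtain ⟨t, ht⟩ := List.head?_eq_some_iff.1 h
    have h1 : (swap i l).1 = t := by rw [swap_of_head? h, ht, List.tail_cons]
    have hc := l.2.1
    have hlen := l.2.2
    rw [ht] at hc hlen
    refine Subtype.ext ?_
    rw [swap_of_head?_ne, h1, ht]
    · rw [h1]
      intro hi
      exact (List.isChain_cons.1 hc).1 i hi rfl
    · rw [h1]
      exact hlen
  · by_cases hR : l.1.length < R
    · refine Subtype.ext ?_
      rw [swap_of_head?, swap_of_head?_ne h hR, List.tail_cons]
      rw [swap_of_head?_ne h hR, List.head?_cons]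
    · have : swap i l = l := by rw [swap, dif_neg h, dif_neg hR]
      rw [this, this]

/-- `swap` as a permutation. -/
def swapPerm (R : ℕ) (i : Fin d) : Equiv.Perm (ReducedWord d R) :=
  Function.Involutive.toPerm (swap i) (swap_swap i)

theorem swapPerm_mul_self (i : Fin d) : swapPerm R i * swapPerm R i = 1 :=
  Equiv.ext fun l => swap_swap i l

end ReducedWord

/-! ### Regular Cayley graphs of large girth -/

namespace InvGraph

open ReducedWord

/-- The group of permutations of the ball generated by the involutions `swapPerm`. -/
def treeGroup (d R : ℕ) : Subgroup (Equiv.Perm (ReducedWord d R)) :=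
  Subgroup.closure (Set.range (swapPerm R))

/-- The generators of `treeGroup`. -/
def treeGen {d : ℕ} (R : ℕ) (i : Fin d) : treeGroup d R :=
  ⟨swapPerm R i, Subgroup.subset_closure ⟨i, rfl⟩⟩

theorem treeGen_mul_self {d : ℕ} (R : ℕ) (i : Fin d) : treeGen R i * treeGen R i = 1 :=
  Subtype.ext (swapPerm_mul_self i)

/-- The Cayley graph of `treeGroup` with respect to its generating involutions. -/
noncomputable def treeCayley (d R : ℕ) : InvGraph.{u} where
  V := ULift (treeGroup d R)
  E := ULift (treeGroup d R × Fin d)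
  fintypeV := Fintype.ofFinite _
  fintypeE := Fintype.ofFinite _
  head e := ⟨treeGen R e.down.2 * e.down.1⟩
  tail e := ⟨e.down.1⟩
  inv e := ⟨(treeGen R e.down.2 * e.down.1, e.down.2)⟩
  inv_inv e := by
    refine ULift.ext _ _ (Prod.ext ?_ rfl)
    simp only [← mul_assoc, treeGen_mul_self, one_mul]
  tail_inv _ := rfl

/-- Edges carry their label, so the degree is `d` even if generators coincide or are trivial. -/
theorem treeCayley_isRegular (d R : ℕ) : (treeCayley.{u} d R).IsRegular d := by
  rintro ⟨g₀⟩
  have : {e : (treeCayley.{u} d R).E | (treeCayley.{u} d R).tail e = ⟨g₀⟩} =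
      Set.range fun i : Fin d => (⟨(g₀, i)⟩ : ULift.{u} (treeGroup d R × Fin d)) := by
    ext ⟨g, i⟩
    constructor
    · intro h
      obtain rfl : g = g₀ := congrArg ULift.down h
      exact ⟨i, rfl⟩
    · rintro ⟨j, hj⟩
      obtain ⟨rfl, rfl⟩ := Prod.mk.inj (congrArg ULift.down hj)
      rfl
  refine (congrArg Set.ncard this).trans ?_
  have hinj : Function.Injective
      fun i : Fin d => (⟨(g₀, i)⟩ : ULift.{u} (treeGroup d R × Fin d)) :=
    fun i j hij => (Prod.mk.inj (congrArg ULift.down hij)).2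
  exact (Nat.card_range_of_injective hinj).trans (Nat.card_fin d)

theorem treeCayley_isConnected (d R : ℕ) : (treeCayley.{u} d R).IsConnected := by
  let G := treeCayley.{u} d R
  let r : G.V → G.V → Prop := fun a b => ∃ e : G.E, G.tail e = a ∧ G.head e = b
  have : Std.Symm r := ⟨fun a b ⟨e, ha, hb⟩ =>
    ⟨G.inv e, by rw [G.tail_inv, hb], by rw [head_inv, ha]⟩⟩
  have key : ∀ x (hx : x ∈ treeGroup d R), ∀ γ : treeGroup d R,
      Relation.ReflTransGen r ⟨γ⟩ ⟨(⟨x, hx⟩ : treeGroup d R) * γ⟩ := by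
    intro x hx
    induction hx using Subgroup.closure_induction with
    | mem x hx =>
      obtain ⟨i, rfl⟩ := hx
      exact fun γ => Relation.ReflTransGen.single ⟨⟨(γ, i)⟩, rfl, rfl⟩
    | one =>
      intro γ
      have : (⟨1, one_mem _⟩ : treeGroup d R) * γ = γ := one_mul γ
      rw [this]
      exact Relation.ReflTransGen.refl
    | mul x y hx hy ihx ihy =>
      intro γ
      have h := (ihy γ).trans (ihx (⟨y, hy⟩ * γ))
      rw [← mul_assoc] at h
      exact h
    | inv x hx ih =>
      intro γ
      have h := ih ((⟨x, hx⟩ : treeGroup d R)⁻¹ * γ)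
      rw [mul_inv_cancel_left] at h
      exact Relation.ReflTransGen.stdSymm.symm _ _ h
  refine ⟨⟨⟨1⟩⟩, fun v w => ?_⟩
  have h := key _ (w.down * v.down⁻¹).2 v.down
  rw [Subtype.coe_eta, inv_mul_cancel_right] at h
  exact h

theorem lt_girth_treeCayley (d R : ℕ) : (R : ℕ∞) < (treeCayley.{u} d R).girth := by
  refine (ENat.add_one_le_iff (ENat.natCast_ne_top R)).1 (le_iInf₂ fun k ⟨hk, w, hw⟩ => ?_)
  by_contra! hlt
  have hkR : k ≤ R := by
    have : k < R + 1 := by exact_mod_cast hlt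
    omega
  let v : ℕ → treeGroup d R × Fin d := fun j => (w ⟨j % k, Nat.mod_lt _ hk⟩).down
  have hv : ∀ j, (v (j + 1)).1 = treeGen R (v j).2 * (v j).1 ∧ (v (j + 1)).2 ≠ (v j).2 := by
    intro j
    obtain ⟨h1, h2⟩ := hw ⟨j % k, Nat.mod_lt _ hk⟩ ⟨(j + 1) % k, Nat.mod_lt _ hk⟩ (by simp)
    have h1' : treeGen R (v j).2 * (v j).1 = (v (j + 1)).1 := congrArg ULift.down h1
    refine ⟨h1'.symm, fun h3 => h2 ?_⟩
    exact ULift.ext _ _ (Prod.ext h1' h3.symm)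
  let o : ReducedWord d R := ⟨[], List.isChain_nil, Nat.zero_le _⟩
  -- The walk, translated to start at the identity, acts on the root. Consecutive labels differ, so
  -- each step lengthens the word by one letter; the ball's boundary is not reached before `R`
  -- steps.
  let l : ℕ → ReducedWord d R := fun j => (v j).1.1 ((v 0).1.1⁻¹ o)
  have hl0 : l 0 = o := by simp [l]
  have hl : ∀ j ≤ k, (l j).1.length = j ∧ (l j).1.head? ≠ some (v j).2 := by
    intro j
    induction j with
    | zero => exact fun _ => by simp [hl0, o]
    | succ j ih =>
      intro hj
      obtain ⟨h1, h2⟩ := ih (by omega)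
      have h3 : l (j + 1) = swap (v j).2 (l j) := by
        simp only [l, (hv j).1]
        rfl
      have h4 := swap_of_head?_ne h2 (by omega)
      rw [h3, h4]
      refine ⟨by simp [h1], ?_⟩
      simpa using (hv j).2.symm
  have hvk : v k = v 0 := by simp [v]
  have hlk : l k = l 0 := by simp only [l, hvk]
  have := (hl k le_rfl).1
  rw [hlk, hl0] at this
  exact hk.ne this

end InvGraph

open InvGraph in
theorem corollary7p4 (r d : ℕ) :
    (∃ g : ℕ, ∀ B : InvGraph.{u}, B.IsRegular d → (g : ℕ∞) < B.girth →
      ∀ C : B.Model, (r : EReal) ≤ C.tanglePower) ∧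
    (∃ B : InvGraph.{u}, B.IsConnected ∧ B.IsRegular d ∧
      ∀ C : B.Model, (r : EReal) ≤ C.tanglePower) :=
  ⟨⟨2 * d ^ (6 * r) + 1, fun _ hB hg C => le_tanglePower hB hg C⟩,
    treeCayley d (2 * d ^ (6 * r) + 1), treeCayley_isConnected _ _, treeCayley_isRegular _ _,
    fun C => le_tanglePower (treeCayley_isRegular _ _) (lt_girth_treeCayley _ _) C⟩
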